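/- **Theorem 4.12.** *Definitions.* Call two-bit strings $x_1x_0$ and $y_1y_0$ pair related, $x_1x_0\sim y_1y_0$, if $(x_1x_0,y_1y_0)\in\{(00,00),(10,10),(01,11),(11,01)\}$. The crossed cube $CQ_n$ has as vertices the binary strings $u_{n-1}\dots u_0$ of length $n$; $CQ_1=K_2$, and for $n\ge 2$ the graph $CQ_n$ consists of two copies of $CQ_{n-1}$, obtained by prefixing its vertices with $0$ and with $1$ respectively, together with all edges joining $0u_{n-2}\dots u_0$ and $1v_{n-2}\dots v_0$ such that $u_{n-2}=v_{n-2}$ if $n$ is even, and $u_{2i+1}u_{2i}\sim v_{2i+1}v_{2i}$ for all $0\le i<\lfloor\frac{n-1}{2}\rfloor$. The vertices of the $n$-dimensional BCDC network $B_n$ ($n\ge2$) are the edges $[x,y]$ of $CQ_n$. The graph $B_2$ is the $4$-cycle $[00,01],[00,10],[10,11],[01,11]$. For $n\ge3$, the graph $B_n$ consists of two copies of $B_{n-1}$, obtained by prefixing $0$ and $1$ respectively, and of the set $S_n$ of the edges of $CQ_n$ that join its two copies of $CQ_{n-1}$; besides the edges inside the two copies of $B_{n-1}$, a vertex of a copy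 and a vertex of $S_n$ are adjacent if and only if, as edges of $CQ_n$, they have an endpoint in common. For a graph $G$ and a set $\mathcal F$ of subgraphs of $G$, let $G-\mathcal F$ be obtained from $G$ by deleting all vertices of all members of $\mathcal F$. For a connected graph $H$, an $H$-substructure cut of $G$ is a set $\mathcal F$ of subgraphs of $G$, each isomorphic to a connected subgraph of $H$, such that $G-\mathcal F$ is disconnected or has exactly one vertex. The $H$-substructure connectivity $\kappa^s(G;H)$ is the smallest size of an $H$-substructure cut of $G$. Let $C_k$ and $P_k$ be the cycle and the path with $k$ vertices. *Statement.* Let $n\ge 4$ and $4\le k\le 2n-1$. Then $\kappa^s(B_n;C_k)=\kappa^s(B_n;P_k)$, and $$\kappa^s(B_n;C_k)=\begin{cases}\dfrac{2n-2}{k}, & \text{if } 4\le k\le n-1 \text{ and } k\mid n-1,\\[2mm] \left\lceil\dfrac{2n-1}{k}\right\rceil, & \text{otherwise.}\end{cases}$$ -/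

import Mathlib

/-- Binary strings `x_{n-1} … x_1 x_0` of length `n`; the value at `i` is the bit `x_i`. -/
abbrev BitString (n : ℕ) : Type := Fin n → Bool

/-- The string `b x_{n-1} … x_0`, obtained by prefixing `x` with the bit `b`. -/
def BitString.prefixed {n : ℕ} (b : Bool) (x : BitString n) : BitString (n + 1) :=
  Fin.snoc (α := fun _ => Bool) x b

/-- Two strings `x_1 x_0` and `y_1 y_0` are pair related when
`(x_1 x_0, y_1 y_0) ∈ {(00, 00), (10, 10), (01, 11), (11, 01)}`. -/
def PairRelated (x₁ x₀ y₁ y₀ : Bool) : Prop :=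
  ((x₁, x₀), (y₁, y₀)) ∈
    ({((false, false), (false, false)), ((true, false), (true, false)),
      ((false, true), (true, true)), ((true, true), (false, true))} :
      Set ((Bool × Bool) × (Bool × Bool)))

/-- The condition under which `0 u_{n-2} … u_0` and `1 v_{n-2} … v_0` are joined in the crossed
cube of dimension `n = m + 1`; here `u` and `v` have length `m = n - 1`. -/
def CrossLinked {m : ℕ} (u v : BitString m) : Prop :=
  (Even (m + 1) → ∀ i : Fin m, (i : ℕ) + 1 = m → u i = v i) ∧
    ∀ (i : ℕ) (h : i < m / 2),
      PairRelated (u ⟨2 * i + 1, by omega⟩) (u ⟨2 * i, by omega⟩)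
        (v ⟨2 * i + 1, by omega⟩) (v ⟨2 * i, by omega⟩)

/-- The crossed cube `CQ_n`. Starting the recursion with the one-vertex graph `CQ_0` yields
`CQ_1 = K_2`. -/
def crossedCube : (n : ℕ) → SimpleGraph (BitString n)
  | 0 => ⊥
  | n + 1 => SimpleGraph.fromRel fun x y =>
      (∃ (b : Bool) (u v : BitString n), (crossedCube n).Adj u v ∧
        x = BitString.prefixed b u ∧ y = BitString.prefixed b v) ∨
      (∃ u v : BitString n, CrossLinked u v ∧
        x = BitString.prefixed false u ∧ y = BitString.prefixed true v)

/-- The links of the BCDC network, by recursion on the dimension. In dimension `2` they are the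
edges of the 4-cycle `[00, 01], [00, 10], [10, 11], [01, 11]`; the string `x_1 x_0` is the vector
`![x_0, x_1]`. In dimension `n ≥ 3` there are the links of the two copies of the
`(n-1)`-dimensional network, and the links between a server of a copy and a server
`[0c, 1d]` in `S_n` that have a switch in common. Every link is listed in one orientation. -/
def bcdcLink : (n : ℕ) → Sym2 (BitString n) → Sym2 (BitString n) → Prop
  | 0, _, _ => False
  | 1, _, _ => False
  | 2, p, q =>
      (p = s(![false, false], ![true, false]) ∧ q = s(![false, false], ![false, true])) ∨
      (p = s(![false, false], ![false, true]) ∧ q = s(![false, true], ![true, true])) ∨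
      (p = s(![false, true], ![true, true]) ∧ q = s(![true, false], ![true, true])) ∨
      (p = s(![true, false], ![true, true]) ∧ q = s(![false, false], ![true, false]))
  | n + 3, p, q =>
      (∃ (b : Bool) (p' q' : Sym2 (BitString (n + 2))), bcdcLink (n + 2) p' q' ∧
        p = p'.map (BitString.prefixed b) ∧ q = q'.map (BitString.prefixed b)) ∨
      (∃ (b : Bool), ∃ e ∈ (crossedCube (n + 2)).edgeSet, ∃ c d : BitString (n + 2),
        (crossedCube (n + 3)).Adj (BitString.prefixed false c) (BitString.prefixed true d) ∧
        p = e.map (BitString.prefixed b) ∧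
        q = s(BitString.prefixed false c, BitString.prefixed true d) ∧
        (bif b then d else c) ∈ e)

/-- The `n`-dimensional BCDC network `B_n`, for `n ≥ 2`: its vertices (the servers) are the edges
`[x, y]` of the crossed cube `CQ_n`. -/
def bcdc (n : ℕ) : SimpleGraph (crossedCube n).edgeSet :=
  SimpleGraph.fromRel fun p q => bcdcLink n p q

/-! The following facts lead to `bcdc_eq_lineGraph`, which confirms that the recursive definition
of the network gives the line graph of the crossed cube. -/

theorem BitString.prefixed_inj {n : ℕ} {b b' : Bool} {x x' : BitString n} :
    BitString.prefixed b x = BitString.prefixed b' x' ↔ b = b' ∧ x = x' := by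
  constructor
  · intro h
    have h1 := congrFun h (Fin.last n)
    have h2 : Fin.init (α := fun _ => Bool) (BitString.prefixed b x) =
        Fin.init (α := fun _ => Bool) (BitString.prefixed b' x') := by rw [h]
    simp only [BitString.prefixed, Fin.snoc_last, Fin.init_snoc] at h1 h2
    exact ⟨h1, h2⟩
  · rintro ⟨rfl, rfl⟩; rfl

theorem CrossLinked.unique {m : ℕ} {u u' v v' : BitString m} (h : CrossLinked u v)
    (h' : CrossLinked u' v') : u = u' ↔ v = v' := by
  have key : ∀ i : Fin m, (∃ j, ∃ _ : j < m / 2, (i : ℕ) = 2 * j ∨ (i : ℕ) = 2 * j + 1) ∨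
      (Even (m + 1) ∧ (i : ℕ) + 1 = m) := by
    intro i
    by_cases hi : (i : ℕ) / 2 < m / 2
    · left; exact ⟨i / 2, hi, by omega⟩
    · right
      have := i.2
      exact ⟨by rw [Nat.even_iff]; omega, by omega⟩
  constructor
  · rintro rfl
    funext i
    rcases key i with ⟨j, hj, hi⟩ | ⟨he, hi⟩
    · have a := h.2 j hj
      have b := h'.2 j hj
      have : ∀ x₁ x₀ y₁ y₀ z₁ z₀ : Bool, PairRelated x₁ x₀ y₁ y₀ → PairRelated x₁ x₀ z₁ z₀ →
          y₁ = z₁ ∧ y₀ = z₀ := by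
        intro x₁ x₀ y₁ y₀ z₁ z₀
        simp only [PairRelated, Set.mem_insert_iff, Set.mem_singleton_iff, Prod.mk.injEq]
        revert x₁ x₀ y₁ y₀ z₁ z₀; decide
      obtain ⟨c, d⟩ := this _ _ _ _ _ _ a b
      rcases hi with hi | hi
      · convert d using 2 <;> exact Fin.ext hi
      · convert c using 2 <;> exact Fin.ext hi
    · rw [← h.1 he i hi, ← h'.1 he i hi]
  · rintro rfl
    funext i
    rcases key i with ⟨j, hj, hi⟩ | ⟨he, hi⟩
    · have a := h.2 j hj
      have b := h'.2 j hj
      have : ∀ x₁ x₀ y₁ y₀ z₁ z₀ : Bool, PairRelated y₁ y₀ x₁ x₀ → PairRelated z₁ z₀ x₁ x₀ →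
          y₁ = z₁ ∧ y₀ = z₀ := by
        intro x₁ x₀ y₁ y₀ z₁ z₀
        simp only [PairRelated, Set.mem_insert_iff, Set.mem_singleton_iff, Prod.mk.injEq]
        revert x₁ x₀ y₁ y₀ z₁ z₀; decide
      obtain ⟨c, d⟩ := this _ _ _ _ _ _ a b
      rcases hi with hi | hi
      · convert d using 2 <;> exact Fin.ext hi
      · convert c using 2 <;> exact Fin.ext hi
    · rw [h.1 he i hi, h'.1 he i hi]

theorem crossedCube_adj_prefixed {n : ℕ} {b b' : Bool} {u v : BitString n} :
    (crossedCube (n + 1)).Adj (BitString.prefixed b u) (BitString.prefixed b' v) ↔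
      (b = b' ∧ (crossedCube n).Adj u v) ∨ (b = false ∧ b' = true ∧ CrossLinked u v) ∨
        (b = true ∧ b' = false ∧ CrossLinked v u) := by
  simp only [crossedCube, SimpleGraph.fromRel_adj, ne_eq, BitString.prefixed_inj]
  constructor
  · rintro ⟨-, (⟨c, x, y, h, ⟨rfl, rfl⟩, rfl, rfl⟩ | ⟨x, y, h, ⟨rfl, rfl⟩, rfl, rfl⟩) |
      (⟨c, x, y, h, ⟨rfl, rfl⟩, rfl, rfl⟩ | ⟨x, y, h, ⟨rfl, rfl⟩, rfl, rfl⟩)⟩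
    · exact Or.inl ⟨rfl, h⟩
    · exact Or.inr (Or.inl ⟨rfl, rfl, h⟩)
    · exact Or.inl ⟨rfl, h.symm⟩
    · exact Or.inr (Or.inr ⟨rfl, rfl, h⟩)
  · rintro (⟨rfl, h⟩ | ⟨rfl, rfl, h⟩ | ⟨rfl, rfl, h⟩)
    · exact ⟨fun e => h.ne e.2, Or.inl (Or.inl ⟨b, u, v, h, ⟨rfl, rfl⟩, rfl, rfl⟩)⟩
    · exact ⟨by simp, Or.inl (Or.inr ⟨u, v, h, ⟨rfl, rfl⟩, rfl, rfl⟩)⟩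
    · exact ⟨by simp, Or.inr (Or.inr ⟨v, u, h, ⟨rfl, rfl⟩, rfl, rfl⟩)⟩

theorem crossedCube_edge_cases {n : ℕ} {p : Sym2 (BitString (n + 1))}
    (hp : p ∈ (crossedCube (n + 1)).edgeSet) :
    (∃ b, ∃ e ∈ (crossedCube n).edgeSet, p = e.map (BitString.prefixed b)) ∨
      ∃ c d, CrossLinked c d ∧ p = s(BitString.prefixed false c, BitString.prefixed true d) := by
  induction p using Sym2.ind with
  | _ x y =>
    rw [SimpleGraph.mem_edgeSet] at hp
    simp only [crossedCube, SimpleGraph.fromRel_adj] at hp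
    rcases hp with ⟨-, (⟨b, u, v, h, rfl, rfl⟩ | ⟨u, v, h, rfl, rfl⟩) |
      (⟨b, u, v, h, rfl, rfl⟩ | ⟨u, v, h, rfl, rfl⟩)⟩
    · exact Or.inl ⟨b, s(u, v), h, rfl⟩
    · exact Or.inr ⟨u, v, h, rfl⟩
    · exact Or.inl ⟨b, s(v, u), h.symm, rfl⟩
    · exact Or.inr ⟨u, v, h, Sym2.eq_swap⟩

theorem mem_edgeSet_map_prefixed {n : ℕ} {b : Bool} {e : Sym2 (BitString n)} :
    e.map (BitString.prefixed b) ∈ (crossedCube (n + 1)).edgeSet ↔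
      e ∈ (crossedCube n).edgeSet := by
  induction e using Sym2.ind with
  | _ x y =>
    rw [Sym2.map_mk, SimpleGraph.mem_edgeSet, SimpleGraph.mem_edgeSet, crossedCube_adj_prefixed]
    cases b <;> simp

theorem map_prefixed_inj {n : ℕ} {b b' : Bool} {e e' : Sym2 (BitString n)} :
    e.map (BitString.prefixed b) = e'.map (BitString.prefixed b') ↔ b = b' ∧ e = e' := by
  constructor
  · intro h
    obtain rfl : b = b' := by
      induction e using Sym2.ind with
      | _ x y =>
        have hx : BitString.prefixed b x ∈ e'.map (BitString.prefixed b') := by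
          rw [← h]; simp
        obtain ⟨z, -, hz⟩ := Sym2.mem_map.1 hx
        exact (BitString.prefixed_inj.1 hz).1.symm
    exact ⟨rfl, Sym2.map.injective (fun x y h => (BitString.prefixed_inj.1 h).2) h⟩
  · rintro ⟨rfl, rfl⟩; rfl

theorem prefixed_mem_map {n : ℕ} {b b' : Bool} {x : BitString n} {e : Sym2 (BitString n)} :
    BitString.prefixed b x ∈ e.map (BitString.prefixed b') ↔ b = b' ∧ x ∈ e := by
  rw [Sym2.mem_map]
  constructor
  · rintro ⟨z, hz, h⟩
    obtain ⟨rfl, rfl⟩ := BitString.prefixed_inj.1 h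
    exact ⟨rfl, hz⟩
  · rintro ⟨rfl, h⟩
    exact ⟨x, h, rfl⟩

theorem map_prefixed_ne {n : ℕ} {b : Bool} {e : Sym2 (BitString n)} {c d : BitString n} :
    e.map (BitString.prefixed b) ≠
      s(BitString.prefixed false c, BitString.prefixed true d) := by
  intro h
  have h1 : BitString.prefixed false c ∈ e.map (BitString.prefixed b) := by rw [h]; simp
  have h2 : BitString.prefixed true d ∈ e.map (BitString.prefixed b) := by rw [h]; simp
  have h3 := (prefixed_mem_map.1 h1).1.trans (prefixed_mem_map.1 h2).1.symm
  exact Bool.false_ne_true h3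

theorem cross_inj {n : ℕ} {c d c' d' : BitString n} :
    s(BitString.prefixed false c, BitString.prefixed true d) =
      s(BitString.prefixed false c', BitString.prefixed true d') ↔ c = c' ∧ d = d' := by
  simp [BitString.prefixed_inj]

theorem bcdcLink_iff_map {m : ℕ}
    (ih : ∀ p ∈ (crossedCube (m + 2)).edgeSet, ∀ q ∈ (crossedCube (m + 2)).edgeSet,
      p ≠ q → ((bcdcLink (m + 2) p q ∨ bcdcLink (m + 2) q p) ↔ ∃ v, v ∈ p ∧ v ∈ q))
    {b b' : Bool} {e e' : Sym2 (BitString (m + 2))}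
    (he : e ∈ (crossedCube (m + 2)).edgeSet) (he' : e' ∈ (crossedCube (m + 2)).edgeSet)
    (hne : e.map (BitString.prefixed b) ≠ e'.map (BitString.prefixed b')) :
    (bcdcLink (m + 3) (e.map (BitString.prefixed b)) (e'.map (BitString.prefixed b')) ∨
      bcdcLink (m + 3) (e'.map (BitString.prefixed b')) (e.map (BitString.prefixed b))) ↔
    ∃ v, v ∈ e.map (BitString.prefixed b) ∧ v ∈ e'.map (BitString.prefixed b') := by
  have key : ∀ {b b' : Bool} {e e' : Sym2 (BitString (m + 2))},
      bcdcLink (m + 3) (e.map (BitString.prefixed b)) (e'.map (BitString.prefixed b')) ↔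
        b = b' ∧ bcdcLink (m + 2) e e' := by
    intro b b' e e'
    rw [bcdcLink]
    constructor
    · rintro (⟨i, p, q, h, hp, hq⟩ | ⟨i, p, hp, c, d, h, -, hq, -⟩)
      · obtain ⟨rfl, rfl⟩ := map_prefixed_inj.1 hp
        obtain ⟨rfl, rfl⟩ := map_prefixed_inj.1 hq
        exact ⟨rfl, h⟩
      · exact absurd hq map_prefixed_ne
    · rintro ⟨rfl, h⟩
      exact Or.inl ⟨b, e, e', h, rfl, rfl⟩
  rw [key, key]
  constructor
  · intro h
    have hb : b = b' := by rcases h with h | h; exacts [h.1, h.1.symm]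
    subst hb
    have hne' : e ≠ e' := fun h => hne (by rw [h])
    obtain ⟨v, h1, h2⟩ := (ih e he e' he' hne').1 (h.imp And.right And.right)
    exact ⟨_, prefixed_mem_map.2 ⟨rfl, h1⟩, prefixed_mem_map.2 ⟨rfl, h2⟩⟩
  · rintro ⟨v, h1, h2⟩
    obtain ⟨x, hx, rfl⟩ := Sym2.mem_map.1 h1
    obtain ⟨rfl, hx'⟩ := prefixed_mem_map.1 h2
    have hne' : e ≠ e' := fun h => hne (by rw [h])
    exact ((ih e he e' he' hne').2 ⟨x, hx, hx'⟩).imp (fun h => ⟨rfl, h⟩) (fun h => ⟨rfl, h⟩)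

theorem bcdcLink_iff_cross {m : ℕ} {b : Bool} {e : Sym2 (BitString (m + 2))}
    {c d : BitString (m + 2)} (he : e ∈ (crossedCube (m + 2)).edgeSet)
    (hcd : CrossLinked c d) :
    (bcdcLink (m + 3) (e.map (BitString.prefixed b))
        s(BitString.prefixed false c, BitString.prefixed true d) ∨
      bcdcLink (m + 3) s(BitString.prefixed false c, BitString.prefixed true d)
        (e.map (BitString.prefixed b))) ↔
    ∃ v, v ∈ e.map (BitString.prefixed b) ∧
      v ∈ s(BitString.prefixed false c, BitString.prefixed true d) := by
  have hadj : (crossedCube (m + 3)).Adj (BitString.prefixed false c)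
      (BitString.prefixed true d) :=
    crossedCube_adj_prefixed.2 (Or.inr (Or.inl ⟨rfl, rfl, hcd⟩))
  rw [bcdcLink, bcdcLink]
  constructor
  · rintro ((⟨i, p, q, h, hp, hq⟩ | ⟨i, p, hp, c', d', h, hi, hq, hm⟩) |
      (⟨i, p, q, h, hp, hq⟩ | ⟨i, p, hp, c', d', h, hi, hq, hm⟩))
    · exact absurd hq.symm map_prefixed_ne
    · obtain ⟨rfl, rfl⟩ := cross_inj.1 hq
      obtain ⟨rfl, rfl⟩ := map_prefixed_inj.1 hi
      cases b
      · exact ⟨_, prefixed_mem_map.2 ⟨rfl, hm⟩, by simp⟩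
      · exact ⟨_, prefixed_mem_map.2 ⟨rfl, hm⟩, by simp⟩
    · exact absurd hp.symm map_prefixed_ne
    · exact absurd hq map_prefixed_ne
  · rintro ⟨v, h1, h2⟩
    rcases Sym2.mem_iff.1 h2 with rfl | rfl
    · obtain ⟨rfl, h⟩ := prefixed_mem_map.1 h1
      exact Or.inl (Or.inr ⟨false, e, he, c, d, hadj, rfl, rfl, h⟩)
    · obtain ⟨rfl, h⟩ := prefixed_mem_map.1 h1
      exact Or.inl (Or.inr ⟨true, e, he, c, d, hadj, rfl, rfl, h⟩)

theorem crossedCube_two_adj {x y : BitString 2} (h : (crossedCube 2).Adj x y) :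
    (x 1 = y 1 ∧ x 0 ≠ y 0) ∨ (x 1 ≠ y 1 ∧ x 0 = y 0) := by
  have hs : ∀ z : BitString 2, ∃ b u, z = BitString.prefixed (n := 1) b u := fun z =>
    ⟨z (Fin.last 1), Fin.init (α := fun _ => Bool) z, (Fin.snoc_init_self _).symm⟩
  have h0 : ∀ (b : Bool) (u : BitString 1), BitString.prefixed b u 0 = u 0 := fun b u =>
    Fin.snoc_castSucc (α := fun _ => Bool) b u 0
  have h1 : ∀ (b : Bool) (u : BitString 1), BitString.prefixed b u 1 = b := fun b u =>
    Fin.snoc_last (α := fun _ => Bool) b u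
  obtain ⟨b, u, rfl⟩ := hs x
  obtain ⟨b', v, rfl⟩ := hs y
  simp only [h0, h1]
  rcases (crossedCube_adj_prefixed (n := 1)).1 h with ⟨hb, hh⟩ | ⟨hb, hb', hh⟩ | ⟨hb, hb', hh⟩
  · refine Or.inl ⟨hb, fun e => hh.ne (funext fun i => ?_)⟩
    rw [Subsingleton.elim i 0, e]
  · exact Or.inr ⟨by simp [hb, hb'], hh.1 (by decide) 0 rfl⟩
  · exact Or.inr ⟨by simp [hb, hb'], (hh.1 (by decide) 0 rfl).symm⟩

set_option synthInstance.maxSize 2000 in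
set_option synthInstance.maxHeartbeats 400000 in
set_option maxRecDepth 10000 in
theorem bcdcLink_two_iff {x y z w : BitString 2}
    (h : (x 1 = y 1 ∧ x 0 ≠ y 0) ∨ (x 1 ≠ y 1 ∧ x 0 = y 0))
    (h' : (z 1 = w 1 ∧ z 0 ≠ w 0) ∨ (z 1 ≠ w 1 ∧ z 0 = w 0)) (hne : s(x, y) ≠ s(z, w)) :
    (bcdcLink 2 s(x, y) s(z, w) ∨ bcdcLink 2 s(z, w) s(x, y)) ↔
      ∃ v, v ∈ s(x, y) ∧ v ∈ s(z, w) := by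
  have hv : ∀ v : BitString 2, ∃ a b, v = ![a, b] := fun v =>
    ⟨v 0, v 1, by ext i; fin_cases i <;> rfl⟩
  have hinj : ∀ a b c d : Bool, (![a, b] : BitString 2) = ![c, d] ↔ a = c ∧ b = d := by decide
  obtain ⟨x₀, x₁, rfl⟩ := hv x
  obtain ⟨y₀, y₁, rfl⟩ := hv y
  obtain ⟨z₀, z₁, rfl⟩ := hv z
  obtain ⟨w₀, w₁, rfl⟩ := hv w
  have hm : (∃ v, v ∈ s((![x₀, x₁] : BitString 2), ![y₀, y₁]) ∧ v ∈ s(![z₀, z₁], ![w₀, w₁])) ↔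
      ((x₀ = z₀ ∧ x₁ = z₁) ∨ (x₀ = w₀ ∧ x₁ = w₁)) ∨ (y₀ = z₀ ∧ y₁ = z₁) ∨ (y₀ = w₀ ∧ y₁ = w₁) := by
    simp [Sym2.mem_iff, or_and_right, exists_or, hinj]
  rw [hm]
  simp only [bcdcLink, Sym2.eq_iff, ne_eq, hinj] at hne ⊢
  simp only [Matrix.cons_val_zero, Matrix.cons_val_one] at h h'
  clear hm hinj hv
  revert x₀ x₁ y₀ y₁ z₀ z₁ w₀ w₁
  decide

theorem bcdcLink_iff (n : ℕ) : ∀ p ∈ (crossedCube n).edgeSet, ∀ q ∈ (crossedCube n).edgeSet,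
    p ≠ q → ((bcdcLink n p q ∨ bcdcLink n q p) ↔ ∃ v, v ∈ p ∧ v ∈ q) := by
  induction n with
  | zero =>
    intro p hp
    induction p using Sym2.ind with
    | _ x y => exact absurd hp (by simp [crossedCube])
  | succ n ih =>
    intro p hp q hq hpq
    match n, ih with
    | 0, _ =>
      exfalso
      apply hpq
      rcases crossedCube_edge_cases hp with ⟨b, e, he, -⟩ | ⟨c, d, -, rfl⟩
      · exact absurd he (by simp [crossedCube])
      rcases crossedCube_edge_cases hq with ⟨b, e, he, -⟩ | ⟨c', d', -, rfl⟩
      · exact absurd he (by simp [crossedCube])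
      rw [Subsingleton.elim c c', Subsingleton.elim d d']
    | 1, _ =>
      induction p using Sym2.ind with
      | _ x y =>
        induction q using Sym2.ind with
        | _ z w =>
          exact bcdcLink_two_iff (crossedCube_two_adj hp) (crossedCube_two_adj hq) hpq
    | m + 2, ih =>
      rcases crossedCube_edge_cases hp with ⟨b, e, he, rfl⟩ | ⟨c, d, hcd, rfl⟩ <;>
      rcases crossedCube_edge_cases hq with ⟨b', e', he', rfl⟩ | ⟨c', d', hcd', rfl⟩
      · exact bcdcLink_iff_map ih he he' hpq
      · exact bcdcLink_iff_cross he hcd'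
      · rw [or_comm, bcdcLink_iff_cross he' hcd]
        simp only [and_comm]
      · constructor
        · rw [bcdcLink, bcdcLink]
          rintro ((⟨i, e, e', h, h1, h2⟩ | ⟨i, e, he, c₁, d₁, h, h1, h2, hm⟩) |
            (⟨i, e, e', h, h1, h2⟩ | ⟨i, e, he, c₁, d₁, h, h1, h2, hm⟩)) <;>
            exact absurd h1.symm map_prefixed_ne
        · rintro ⟨v, h1, h2⟩
          exfalso
          apply hpq
          rw [cross_inj]
          have hu := hcd.unique hcd'
          rcases Sym2.mem_iff.1 h1 with rfl | rfl <;>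
          rcases Sym2.mem_iff.1 h2 with h | h <;>
          have h3 := BitString.prefixed_inj.1 h
          · exact ⟨h3.2, hu.1 h3.2⟩
          · exact absurd h3.1 (by simp)
          · exact absurd h3.1 (by simp)
          · exact ⟨hu.2 h3.2, h3.2⟩

/-- The BCDC network is the line graph of the crossed cube. -/
theorem bcdc_eq_lineGraph (n : ℕ) : bcdc n = (crossedCube n).lineGraph := by
  ext p q
  rw [SimpleGraph.lineGraph_adj_iff_exists, bcdc, SimpleGraph.fromRel_adj]
  constructor
  · rintro ⟨h, h'⟩
    exact ⟨h, (bcdcLink_iff n p p.2 q q.2 (fun e => h (Subtype.ext e))).1 h'⟩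
  · rintro ⟨h, h'⟩
    exact ⟨h, (bcdcLink_iff n p p.2 q q.2 (fun e => h (Subtype.ext e))).2 h'⟩

/-- `G - 𝓕` is disconnected or a trivial (that is, one-vertex) graph, where `G - 𝓕` is obtained
from `G` by deleting all vertices of all members of `𝓕`. -/
def IsSubgraphCut {V : Type*} (G : SimpleGraph V) (F : Set G.Subgraph) : Prop :=
  ¬ (G.induce (⋃ S ∈ F, S.verts)ᶜ).Preconnected ∨ ∃ x, (⋃ S ∈ F, S.verts)ᶜ = {x}

/-- An `H`-substructure cut of `G`: a subgraph cut all of whose members are isomorphic to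
connected subgraphs of `H`. -/
def IsSubstructureCut {V W : Type*} (G : SimpleGraph V) (H : SimpleGraph W)
    (F : Set G.Subgraph) : Prop :=
  IsSubgraphCut G F ∧
    ∀ S ∈ F, ∃ K : H.Subgraph, K.Connected ∧ Nonempty (S.coe ≃g K.coe)

/-- The `H`-substructure connectivity `κ^s(G; H)`: the least size of an `H`-substructure cut of
`G` (`⊤` if there is none). -/
noncomputable def substructureConnectivity {V W : Type*} (G : SimpleGraph V)
    (H : SimpleGraph W) : ℕ∞ :=
  ⨅ F ∈ {F : Set G.Subgraph | IsSubstructureCut G H F}, F.encard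

/-! By `bcdc_eq_lineGraph`, the network is the line graph of the crossed cube, an `n`-regular
triangle-free graph. A disconnecting set `U` of the line graph contains the edge boundary of a
vertex set `X`, where `X` and its complement each span an edge outside `U`. Take the smaller side.
If it has at least three vertices, edge isoperimetry gives at least `2n - 1` boundary edges.
Otherwise it is an edge `e = xy`, and `U` contains the `2n - 2` edges adjacent to `e`. Hence `|U| ≥
2n - 1` or `U` is exactly the neighbourhood of `e` (`lineGraph_crossedCube_cut_dichotomy`).

That neighbourhood consists of two cliques of size `n - 1`, the remaining edges at `x` and at `y`;
triangle-freeness forbids adjacency between them. Members of a cut are connected with at most `k`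
vertices. So either `|F| k ≥ 2n - 1`, or each member lies in one clique and the cliques use `p` and
`q` members with `pk, qk ≥ n - 1`. If `k ∤ n - 1`, the latter inequalities are strict and again `|F|
k ≥ 2n - 1`.

For the upper bounds, a clique is traversed by a path, and paths are chopped into pieces of at most
`k` vertices. Chopping the cliques separately is optimal when `k ∣ n - 1`. Otherwise one extra
vertex of the line graph joins the two into a single path on `2n - 1` vertices.

The pattern graph enters only through having `k` vertices and containing the path on all of them, so
cycles and paths are treated at once. -/

/-! ### Local structure of the crossed cube -/

/-- The string to which `u` is linked in the other copy of the crossed cube. -/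
def crossPartner {m : ℕ} (u : BitString m) : BitString m := fun i =>
  if (i : ℕ) % 2 = 1 then xor (u i) (u ⟨i - 1, by omega⟩) else u i

theorem pairRelated_iff {x₁ x₀ y₁ y₀ : Bool} :
    PairRelated x₁ x₀ y₁ y₀ ↔ y₁ = xor x₁ x₀ ∧ y₀ = x₀ := by
  simp only [PairRelated, Set.mem_insert_iff, Set.mem_singleton_iff, Prod.mk.injEq]
  revert x₁ x₀ y₁ y₀
  decide

theorem crossLinked_crossPartner {m : ℕ} (u : BitString m) : CrossLinked u (crossPartner u) := by
  constructor
  · intro he i hi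
    -- An even dimension makes the top index `m - 1` even, so the unpaired top bit is among those
    -- left unchanged.
    have : (i : ℕ) % 2 ≠ 1 := by rw [Nat.even_iff] at he; omega
    simp [crossPartner, this]
  · intro i h
    rw [pairRelated_iff]
    constructor
    · have : (2 * i + 1) % 2 = 1 := by omega
      simp [crossPartner, this]
    · simp [crossPartner]

theorem crossLinked_iff {m : ℕ} {u v : BitString m} : CrossLinked u v ↔ v = crossPartner u := by
  constructor
  · intro h
    exact (h.unique (crossLinked_crossPartner u)).1 rfl
  · rintro rfl
    exact crossLinked_crossPartner u

/-- Even-indexed bits are fixed, so each odd-indexed bit is XORed twice with the same bit. The edges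
between the two halves thus form a perfect matching. -/
theorem crossPartner_involutive {m : ℕ} : Function.Involutive (crossPartner (m := m)) := by
  intro u
  funext i
  by_cases h : (i : ℕ) % 2 = 1
  · have h' : ((i : ℕ) - 1) % 2 ≠ 1 := by omega
    simp [crossPartner, h, h']
  · simp [crossPartner, h]

theorem crossedCube_adj_prefixed_iff {n : ℕ} {b b' : Bool} {u v : BitString n} :
    (crossedCube (n + 1)).Adj (BitString.prefixed b u) (BitString.prefixed b' v) ↔
      (b = b' ∧ (crossedCube n).Adj u v) ∨ (b ≠ b' ∧ v = crossPartner u) := by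
  rw [crossedCube_adj_prefixed, crossLinked_iff, crossLinked_iff]
  have h : u = crossPartner v ↔ v = crossPartner u :=
    ⟨fun h => by rw [h, crossPartner_involutive], fun h => by rw [h, crossPartner_involutive]⟩
  rw [h]
  cases b <;> cases b' <;> simp

theorem BitString.exists_prefixed {n : ℕ} (x : BitString (n + 1)) :
    ∃ b u, x = BitString.prefixed b u :=
  ⟨x (Fin.last n), Fin.init (α := fun _ => Bool) x, (Fin.snoc_init_self _).symm⟩

/-- A triangle not inside one half would have two vertices in one half with the same partner in the
other, but partners are unique. -/
theorem crossedCube_triangle_free {n : ℕ} {x y z : BitString n} (hxy : (crossedCube n).Adj x y)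
    (hyz : (crossedCube n).Adj y z) (hxz : (crossedCube n).Adj x z) : False := by
  induction n with
  | zero => simp [crossedCube] at hxy
  | succ n ih =>
    obtain ⟨a, u, rfl⟩ := x.exists_prefixed
    obtain ⟨b, v, rfl⟩ := y.exists_prefixed
    obtain ⟨c, w, rfl⟩ := z.exists_prefixed
    rw [crossedCube_adj_prefixed_iff] at hxy hyz hxz
    have hinj := crossPartner_involutive (m := n) |>.injective
    rcases hxy with ⟨rfl, h1⟩ | ⟨h1, h1'⟩ <;> rcases hyz with ⟨rfl, h2⟩ | ⟨h2, h2'⟩ <;>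
      rcases hxz with ⟨h3, h3'⟩ | ⟨h3, h3'⟩
    · exact ih h1 h2 h3'
    · exact h3 rfl
    · exact h2 h3
    · exact h1.ne (hinj (h3'.symm.trans h2'))
    · exact h1 h3
    · exact h2.ne (h1'.trans h3'.symm)
    · refine h3'.ne ?_
      rw [h2', h1', crossPartner_involutive]
    · have : ∀ a b c : Bool, a ≠ b → b ≠ c → a ≠ c → False := by decide
      exact this _ _ _ h1 h2 h3

/-- In the line graph, the edge `ab` opposite to `xy` links an edge at `x` to an edge at `y` without
meeting `xy`; this is the connector in the upper bound. -/
theorem crossedCube_exists_four_cycle {n : ℕ} (hn : 2 ≤ n) : ∃ x y a b : BitString n,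
    (crossedCube n).Adj x y ∧ (crossedCube n).Adj x a ∧ (crossedCube n).Adj y b ∧
      (crossedCube n).Adj a b ∧ a ≠ y ∧ b ≠ x := by
  induction n, hn using Nat.le_induction with
  | base =>
    have hp : ∀ u : BitString 1, crossPartner u = u := by
      intro u; funext i
      simp [crossPartner]
    have h1 : (crossedCube 1).Adj (BitString.prefixed false ![]) (BitString.prefixed true ![]) :=
      crossedCube_adj_prefixed_iff.2 (Or.inr ⟨by simp, Subsingleton.elim _ _⟩)
    refine ⟨BitString.prefixed false (BitString.prefixed false ![]),
      BitString.prefixed false (BitString.prefixed true ![]),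
      BitString.prefixed true (BitString.prefixed false ![]),
      BitString.prefixed true (BitString.prefixed true ![]), ?_⟩
    simp only [crossedCube_adj_prefixed_iff (n := 1), hp, h1, ne_eq, BitString.prefixed_inj]
    simp
  | succ n hn ih =>
    obtain ⟨x, y, a, b, h⟩ := ih
    refine ⟨BitString.prefixed false x, BitString.prefixed false y, BitString.prefixed false a,
      BitString.prefixed false b, ?_⟩
    simpa [crossedCube_adj_prefixed_iff, BitString.prefixed_inj] using h

open Classical in
theorem BitString.sum_prefixed {n : ℕ} (S : Finset (BitString (n + 1)))
    (f : BitString (n + 1) → ℕ) :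
    ∑ x ∈ S, f x = ∑ b, ∑ u with BitString.prefixed b u ∈ S, f (BitString.prefixed b u) := by
  have hS : S = (Finset.univ.filter fun p : Bool × BitString n =>
      BitString.prefixed p.1 p.2 ∈ S).map
        ⟨fun p => BitString.prefixed p.1 p.2, fun p q h =>
          Prod.ext (BitString.prefixed_inj.1 h).1 (BitString.prefixed_inj.1 h).2⟩ := by
    ext x
    obtain ⟨b, u, rfl⟩ := x.exists_prefixed
    simp only [Finset.mem_map, Finset.mem_filter, Finset.mem_univ, true_and, Prod.exists]
    exact ⟨fun h => ⟨b, u, h, rfl⟩, fun ⟨_, _, h, e⟩ => e ▸ h⟩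
  conv_lhs => rw [hS]
  rw [Finset.sum_map, Finset.sum_filter, Fintype.sum_prod_type]
  simp only [Finset.sum_filter]
  rfl

open Classical in
theorem crossedCube_degree (n : ℕ) (x : BitString n) : (crossedCube n).degree x = n := by
  induction n with
  | zero =>
    rw [← SimpleGraph.card_neighborFinset_eq_degree, SimpleGraph.neighborFinset_eq_filter]
    simp [crossedCube]
  | succ n ih =>
    obtain ⟨b, u, rfl⟩ := x.exists_prefixed
    rw [← SimpleGraph.card_neighborFinset_eq_degree, SimpleGraph.neighborFinset_eq_filter,
      Finset.card_filter, BitString.sum_prefixed]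
    have h := ih u
    rw [← SimpleGraph.card_neighborFinset_eq_degree, SimpleGraph.neighborFinset_eq_filter] at h
    simp only [crossedCube_adj_prefixed_iff, Finset.mem_univ, Finset.filter_true]
    cases b <;> simp [h, Finset.filter_eq', add_comm]

/-! ### Edge isoperimetry -/

/-- This is the induction step of the isoperimetric inequality: parts of sizes `a ≤ b` in the two
halves are joined by at most `a` matching edges, counted once in each direction. -/
theorem mul_log_add_le {a b : ℝ} (ha : 0 ≤ a) (hab : a ≤ b) :
    a * Real.log a + b * Real.log b + 2 * a * Real.log 2 ≤ (a + b) * Real.log (a + b) := by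
  rcases ha.eq_or_lt with rfl | ha
  · simp
  have hb : 0 < b := ha.trans_le hab
  have h1 : Real.log 2 + Real.log a ≤ Real.log (a + b) := by
    rw [← Real.log_mul (by norm_num) ha.ne']
    exact Real.log_le_log (by positivity) (by linarith)
  have h2 : a * Real.log 2 ≤ b * (Real.log (a + b) - Real.log b) := by
    -- Bernoulli's inequality with exponent `b / a ≥ 1` gives `(1 + a / b) ^ (b / a) ≥ 2`.
    have h := one_add_mul_self_le_rpow_one_add (s := a / b) (p := b / a)
      (by have : 0 < a / b := by positivity
          linarith) ((one_le_div ha).2 hab)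
    have e : b / a * (a / b) = 1 := by field_simp
    rw [e] at h
    have h' := Real.log_le_log (by norm_num) h
    have e' : 1 + a / b = (a + b) / b := by field_simp; ring
    rw [e', Real.log_rpow (by positivity), Real.log_div (by positivity) hb.ne'] at h'
    norm_num at h'
    calc a * Real.log 2 ≤ a * (b / a * (Real.log (a + b) - Real.log b)) := by gcongr
      _ = _ := by field_simp
  nlinarith

open Classical in
/-- The edge-isoperimetric inequality of the crossed cube: a set of `s` vertices spans at most
`(s log₂ s) / 2` edges. -/
theorem crossedCube_sum_adj_le {n : ℕ} (S : Finset (BitString n)) :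
    ((∑ x ∈ S, ∑ y ∈ S, if (crossedCube n).Adj x y then 1 else 0 : ℕ) : ℝ) * Real.log 2 ≤
      S.card * Real.log S.card := by
  induction n with
  | zero =>
    have : ∀ x y, ¬ (crossedCube 0).Adj x y := by simp [crossedCube]
    simp only [this, if_false, Finset.sum_const_zero, Nat.cast_zero, zero_mul]
    exact mul_nonneg (Nat.cast_nonneg _) (Real.log_natCast_nonneg _)
  | succ n ih =>
    set T : Bool → Finset (BitString n) := fun b =>
      Finset.univ.filter fun u => BitString.prefixed b u ∈ S with hT
    have hcard : S.card = (T false).card + (T true).card := by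
      rw [Finset.card_eq_sum_ones, BitString.sum_prefixed]
      simp [T, add_comm]
    -- Ordered adjacent pairs are counted, so each edge counts twice; the last two sums are the
    -- matching edges seen from either side.
    have hsum : (∑ x ∈ S, ∑ y ∈ S, if (crossedCube (n + 1)).Adj x y then 1 else 0) =
        (∑ x ∈ T false, ∑ y ∈ T false, if (crossedCube n).Adj x y then 1 else 0) +
        (∑ x ∈ T true, ∑ y ∈ T true, if (crossedCube n).Adj x y then 1 else 0) +
        ((∑ x ∈ T false, if crossPartner x ∈ T true then 1 else 0) +
          (∑ x ∈ T true, if crossPartner x ∈ T false then 1 else 0)) := by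
      simp only [BitString.sum_prefixed S, crossedCube_adj_prefixed_iff]
      simp only [Fintype.sum_bool, Finset.sum_add_distrib, T]
      simp
      ring
    have hbound : ∀ b, (∑ x ∈ T b, if crossPartner x ∈ T (!b) then 1 else 0) ≤ (T b).card := by
      intro b
      rw [← Finset.card_filter]
      exact Finset.card_filter_le _ _
    have hbound' : ∀ b, (∑ x ∈ T b, if crossPartner x ∈ T (!b) then 1 else 0) ≤
        (T (!b)).card := by
      intro b
      rw [← Finset.card_filter]
      exact Finset.card_le_card_of_injOn crossPartner
        (fun x hx => (Finset.mem_filter.1 hx).2) crossPartner_involutive.injective.injOn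
    have h0 := ih (T false)
    have h1 := ih (T true)
    have b0 := hbound false
    have b1 := hbound true
    have b0' := hbound' false
    have b1' := hbound' true
    simp only [Bool.not_false, Bool.not_true] at b0 b1 b0' b1'
    rw [hsum, hcard]
    set P := ∑ x ∈ T false, if crossPartner x ∈ T true then 1 else 0
    set Q := ∑ x ∈ T true, if crossPartner x ∈ T false then 1 else 0
    push_cast at h0 h1 ⊢
    have hl : 0 < Real.log 2 := Real.log_pos (by norm_num)
    rcases le_total (T false).card (T true).card with h | h
    · have hm := mul_log_add_le (a := (T false).card) (b := (T true).card) (by positivity)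
        (by exact_mod_cast h)
      have : ((P : ℝ) + Q) * Real.log 2 ≤ 2 * (T false).card * Real.log 2 := by
        gcongr
        exact_mod_cast (by omega : P + Q ≤ 2 * (T false).card)
      linarith
    · have hm := mul_log_add_le (a := (T true).card) (b := (T false).card) (by positivity)
        (by exact_mod_cast h)
      have : ((P : ℝ) + Q) * Real.log 2 ≤ 2 * (T true).card * Real.log 2 := by
        gcongr
        exact_mod_cast (by omega : P + Q ≤ 2 * (T true).card)
      rw [add_comm ((T true).card : ℝ) ((T false).card : ℝ)] at hm
      linarith

-- By regularity, the boundary is at least `s n - s log₂ s` for `s = |S|`. This is concave in `s`,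
-- so it suffices to bound it at the endpoints `3` and `2 ^ (n - 1)`.
open Classical in
theorem crossedCube_le_boundary {n : ℕ} (hn : 4 ≤ n) {S : Finset (BitString n)}
    (h3 : 3 ≤ S.card) (hS : S.card ≤ 2 ^ (n - 1)) :
    2 * n - 1 ≤ ∑ x ∈ S, ∑ y ∈ Sᶜ, if (crossedCube n).Adj x y then 1 else 0 := by
  have hdeg : (∑ x ∈ S, ∑ y ∈ S, if (crossedCube n).Adj x y then 1 else 0) +
      (∑ x ∈ S, ∑ y ∈ Sᶜ, if (crossedCube n).Adj x y then 1 else 0) = S.card * n := by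
    rw [← Finset.sum_add_distrib, ← smul_eq_mul, ← Finset.sum_const]
    refine Finset.sum_congr rfl fun x _ => ?_
    rw [Finset.sum_add_sum_compl, ← Finset.card_filter, ← SimpleGraph.neighborFinset_eq_filter,
      SimpleGraph.card_neighborFinset_eq_degree, crossedCube_degree]
  have hI := crossedCube_sum_adj_le S
  set I := ∑ x ∈ S, ∑ y ∈ S, if (crossedCube n).Adj x y then 1 else 0
  set D := ∑ x ∈ S, ∑ y ∈ Sᶜ, if (crossedCube n).Adj x y then 1 else 0
  have hl : 0 < Real.log 2 := Real.log_pos (by norm_num)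
  have hconc : ConcaveOn ℝ (Set.Ici 0) (fun t : ℝ => t * (n * Real.log 2) + Real.negMulLog t) := by
    refine ConcaveOn.add ?_ Real.concaveOn_negMulLog
    exact (concaveOn_id (convex_Ici 0)).smul (c := (n * Real.log 2 : ℝ)) (by positivity) |>.congr
      (fun t _ => by simp [mul_comm])
  have hmin := hconc.min_le_of_mem_Icc (x := 3) (y := (2 : ℝ) ^ (n - 1)) (z := (S.card : ℝ))
    (by simp) (by simp) ⟨by exact_mod_cast h3, by exact_mod_cast hS⟩
  have hlow : (2 * n - 1 : ℝ) * Real.log 2 ≤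
      S.card * (n * Real.log 2) + Real.negMulLog S.card := by
    refine le_trans (le_min ?_ ?_) hmin
    -- From `27 ≤ 32`: the value at `3` is at least `3n - 5`, which is at least `2n - 1` since `n ≥
    -- 4`.
    · have h3' : 3 * Real.log 3 ≤ 5 * Real.log 2 := by
        have := Real.log_le_log (x := (3 : ℝ) ^ 3) (y := 2 ^ 5) (by norm_num) (by norm_num)
        rw [Real.log_pow, Real.log_pow] at this
        exact_mod_cast this
      have hn' : (4 : ℝ) ≤ n := by exact_mod_cast hn
      simp only [Real.negMulLog]
      nlinarith
    -- At `s = 2 ^ (n - 1)` the bound equals `2 ^ (n - 1)`; `hp` is used with `m = n - 1`.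
    · have hp : ∀ m : ℕ, 3 ≤ m → 2 * m + 1 ≤ 2 ^ m := by
        intro m hm
        induction m, hm using Nat.le_induction with
        | base => norm_num
        | succ m hm ih => rw [pow_succ]; omega
      obtain ⟨m, rfl⟩ : ∃ m, n = m + 1 := ⟨n - 1, by omega⟩
      have := hp m (by omega)
      have h' : (2 * m + 1 : ℝ) ≤ 2 ^ m := by exact_mod_cast this
      simp only [Real.negMulLog, Nat.add_sub_cancel, Real.log_pow]
      push_cast
      nlinarith
  have hdeg' : (I : ℝ) + D = S.card * n := by exact_mod_cast hdeg
  have hfin : (2 * n - 1 : ℝ) * Real.log 2 ≤ D * Real.log 2 := by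
    simp only [Real.negMulLog] at hlow
    have : (D : ℝ) = S.card * n - I := by linarith
    rw [this]
    linarith
  have := le_of_mul_le_mul_right hfin hl
  have h2 : (2 * n : ℝ) ≤ D + 1 := by linarith
  have h3 : 2 * n ≤ D + 1 := by exact_mod_cast h2
  omega

/-! ### Chopping paths into admissible pieces -/

/-- The path on `l.length` vertices is copied into `G` along `l` and into `H` as an initial segment
of its spanning path; the two images are isomorphic. -/
theorem exists_subgraph_of_isChain {V : Type*} {G : SimpleGraph V} {k : ℕ}
    {H : SimpleGraph (Fin k)} (hH : SimpleGraph.pathGraph k ≤ H) {l : List V} (hl : l ≠ [])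
    (hc : l.IsChain G.Adj) (hd : l.Nodup) (hk : l.length ≤ k) :
    ∃ S : G.Subgraph, S.verts = {v | v ∈ l} ∧
      ∃ K : H.Subgraph, K.Connected ∧ Nonempty (S.coe ≃g K.coe) := by
  let f : SimpleGraph.Copy (SimpleGraph.pathGraph l.length) G :=
    ⟨⟨fun i => l[i], by
      intro i j h
      rw [List.isChain_iff_getElem] at hc
      rcases SimpleGraph.pathGraph_adj.1 h with h | h
      · have := hc i (by omega)
        simpa [h] using this
      · have := hc j (by omega)
        simpa [h] using this.symm⟩, fun i j h => Fin.ext ((hd.getElem_inj_iff).1 h)⟩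
  let g : SimpleGraph.Copy (SimpleGraph.pathGraph l.length) H :=
    ⟨⟨Fin.castLE hk, fun {i j} h => hH (by
      rw [SimpleGraph.pathGraph_adj] at h ⊢
      simpa using h)⟩, Fin.castLE_injective hk⟩
  refine ⟨f.toSubgraph, ?_, g.toSubgraph, ?_, ⟨f.isoToSubgraph.symm.trans g.isoToSubgraph⟩⟩
  · ext v
    simp only [SimpleGraph.Subgraph.map_verts, SimpleGraph.Subgraph.verts_top, Set.image_univ,
      Set.mem_range, Set.mem_ofPred_eq, List.mem_iff_getElem]
    exact ⟨fun ⟨i, h⟩ => ⟨i, i.2, h⟩, fun ⟨i, hi, h⟩ => ⟨⟨i, hi⟩, h⟩⟩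
  · rw [SimpleGraph.Subgraph.connected_iff', ← g.isoToSubgraph.connected_iff]
    obtain ⟨m, hm⟩ : ∃ m, l.length = m + 1 :=
      ⟨l.length - 1, by have := List.length_pos_iff.2 hl; omega⟩
    rw [hm]
    exact SimpleGraph.pathGraph_connected m

theorem exists_cover_of_isChain {V : Type*} {G : SimpleGraph V} {k : ℕ}
    {H : SimpleGraph (Fin k)} (hH : SimpleGraph.pathGraph k ≤ H) (m : ℕ) {l : List V}
    (hc : l.IsChain G.Adj) (hd : l.Nodup) (hk : l.length ≤ m * k) :
    ∃ F : Set G.Subgraph, F.encard ≤ m ∧ (⋃ S ∈ F, S.verts) = {v | v ∈ l} ∧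
      ∀ S ∈ F, ∃ K : H.Subgraph, K.Connected ∧ Nonempty (S.coe ≃g K.coe) := by
  induction m generalizing l with
  | zero =>
    have : l = [] := List.length_eq_zero_iff.1 (by omega)
    subst this
    exact ⟨∅, by simp⟩
  | succ m ih =>
    have hsplit : l.take k ++ l.drop k = l := List.take_append_drop k l
    obtain ⟨F, hF, hU, hS⟩ := ih (l := l.drop k) (hc.drop k) (hd.sublist (List.drop_sublist k l))
      (by rw [List.length_drop]; rw [add_mul] at hk; omega)
    -- Members must be nonempty because they are connected, so an empty piece is omitted.
    by_cases he : l.take k = []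
    · refine ⟨F, hF.trans (by exact_mod_cast Nat.le_succ m), ?_, hS⟩
      rw [hU]
      rw [he, List.nil_append] at hsplit
      rw [hsplit]
    · obtain ⟨S, hSv, hK⟩ := exists_subgraph_of_isChain hH he (hc.take k)
        (hd.sublist (List.take_sublist k l)) (List.length_take_le k l)
      refine ⟨insert S F, (Set.encard_insert_le F S).trans ?_, ?_, ?_⟩
      · push_cast
        gcongr
      · rw [Set.biUnion_insert, hU, hSv]
        ext v
        change v ∈ l.take k ∨ v ∈ l.drop k ↔ v ∈ l
        rw [← List.mem_append, hsplit]
      · rintro T (rfl | hT)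
        exacts [hK, hS T hT]

theorem ncard_verts_le_of_iso {V : Type*} {G : SimpleGraph V} {k : ℕ} {H : SimpleGraph (Fin k)}
    {S : G.Subgraph} {K : H.Subgraph} (e : S.coe ≃g K.coe) : S.verts.ncard ≤ k := by
  rw [← Nat.card_coe_set_eq, Nat.card_congr e.toEquiv, Nat.card_coe_set_eq]
  simpa using Set.ncard_le_card K.verts

open Classical in
theorem ncard_biUnion_verts_le {V : Type*} [Finite V] {G : SimpleGraph V} {k : ℕ}
    {F : Set G.Subgraph} (hf : F.Finite) (hk : ∀ S ∈ F, S.verts.ncard ≤ k) :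
    (⋃ S ∈ F, S.verts).ncard ≤ F.ncard * k := by
  have := Fintype.ofFinite V
  have h := Finset.card_biUnion_le_card_mul hf.toFinset (fun S => S.verts.toFinset) k
    (fun S hS => by
      rw [← Set.ncard_eq_toFinset_card']
      exact hk S (by simpa using hS))
  rw [Set.ncard_eq_toFinset_card F hf]
  convert h
  rw [← Set.ncard_coe_finset]
  congr
  ext v
  simp

/-! ### Vertex cuts of the line graph -/

/-- The edges other than `e` that contain `x`. -/
def edgesAt {V : Type*} (G : SimpleGraph V) (x : V) (e : G.edgeSet) : Set G.edgeSet :=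
  {g | x ∈ g.1 ∧ g ≠ e}

theorem isClique_edgesAt {V : Type*} {G : SimpleGraph V} {x : V} {e g h : G.edgeSet}
    (hg : g ∈ edgesAt G x e) (hh : h ∈ edgesAt G x e) (hne : g ≠ h) : G.lineGraph.Adj g h :=
  SimpleGraph.lineGraph_adj_iff_exists.2 ⟨hne, x, hg.1, hh.1⟩

theorem disjoint_edgesAt {V : Type*} {G : SimpleGraph V} {x y : V} {e : G.edgeSet}
    (he : e.1 = s(x, y)) : Disjoint (edgesAt G x e) (edgesAt G y e) := by
  rw [Set.disjoint_left]
  rintro g ⟨hx, hne⟩ ⟨hy, -⟩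
  have hxy : x ≠ y := by
    have := e.2
    rw [he, SimpleGraph.mem_edgeSet] at this
    exact this.ne
  exact hne (Subtype.ext (((Sym2.mem_and_mem_iff hxy).1 ⟨hx, hy⟩).trans he.symm))

open Classical in
theorem ncard_edgesAt {V : Type*} [Fintype V] {G : SimpleGraph V} {x : V}
    {e : G.edgeSet} (hx : x ∈ e.1) : (edgesAt G x e).ncard = G.degree x - 1 := by
  have h : Subtype.val '' edgesAt G x e = ((G.incidenceFinset x).erase e.1 : Finset (Sym2 V)) := by
    ext g
    simp only [edgesAt, Set.mem_image, Set.mem_ofPred_eq, Finset.coe_erase, Set.mem_sdiff,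
      Finset.mem_coe, SimpleGraph.mem_incidenceFinset, SimpleGraph.incidenceSet,
      Set.mem_singleton_iff]
    constructor
    · rintro ⟨g, ⟨h1, h2⟩, rfl⟩
      exact ⟨⟨g.2, h1⟩, fun h => h2 (Subtype.ext h)⟩
    · rintro ⟨⟨h1, h2⟩, h3⟩
      exact ⟨⟨g, h1⟩, ⟨h2, fun h => h3 (by rw [← h])⟩, rfl⟩
  rw [← Set.ncard_image_of_injective _ Subtype.val_injective, h, Set.ncard_coe_finset,
    Finset.card_erase_of_mem, SimpleGraph.card_incidenceFinset_eq_degree]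
  rw [SimpleGraph.mem_incidenceFinset]
  exact ⟨e.2, hx⟩

/-- A common endpoint of the two edges would form a triangle with `x` and `y`; if it were `x` or `y`
itself, one of the edges would be `e`. -/
theorem not_adj_edgesAt {V : Type*} {G : SimpleGraph V}
    (htri : ∀ x y z, G.Adj x y → G.Adj y z → G.Adj x z → False) {x y : V} {e g h : G.edgeSet}
    (he : e.1 = s(x, y)) (hg : g ∈ edgesAt G x e) (hh : h ∈ edgesAt G y e) :
    ¬ G.lineGraph.Adj g h := by
  rw [SimpleGraph.lineGraph_adj_iff_exists]
  rintro ⟨-, z, hzg, hzh⟩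
  have hdis := Set.disjoint_left.1 (disjoint_edgesAt he)
  have hxy := e.2
  rw [he, SimpleGraph.mem_edgeSet] at hxy
  by_cases hzx : z = x
  · exact hdis ⟨hzx ▸ hzh, hh.2⟩ hh
  by_cases hzy : z = y
  · exact hdis hg ⟨hzy ▸ hzg, hg.2⟩
  have h1 := g.2
  have h2 := h.2
  rw [(Sym2.mem_and_mem_iff (Ne.symm hzx)).1 ⟨hg.1, hzg⟩, SimpleGraph.mem_edgeSet] at h1
  rw [(Sym2.mem_and_mem_iff (Ne.symm hzy)).1 ⟨hh.1, hzh⟩, SimpleGraph.mem_edgeSet] at h2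
  exact htri x y z hxy h2 h1

/-- A vertex cut of the line graph contains the edge boundary of a set of vertices such that both
the set and its complement span an edge outside of the cut. -/
theorem exists_boundary_subset_of_not_preconnected {V : Type*} {G : SimpleGraph V}
    {U : Set G.edgeSet} (hU : ¬ (G.lineGraph.induce Uᶜ).Preconnected) :
    ∃ (X : Set V) (e f : G.edgeSet), e ∉ U ∧ f ∉ U ∧ (∀ v ∈ e.1, v ∈ X) ∧ (∀ v ∈ f.1, v ∉ X) ∧
      ∀ g : G.edgeSet, ∀ x ∈ g.1, ∀ y ∈ g.1, x ∈ X → y ∉ X → g ∈ U := by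
  simp only [SimpleGraph.Preconnected, not_forall] at hU
  obtain ⟨⟨e, he⟩, ⟨f, hf⟩, hef⟩ := hU
  have hstep : ∀ (g h : G.edgeSet) (hg : g ∉ U) (hh : h ∉ U) (v : V), v ∈ g.1 → v ∈ h.1 →
      (G.lineGraph.induce Uᶜ).Reachable ⟨e, he⟩ ⟨g, hg⟩ →
      (G.lineGraph.induce Uᶜ).Reachable ⟨e, he⟩ ⟨h, hh⟩ := by
    intro g h hg hh v hvg hvh hr
    by_cases hgh : g = h
    · subst hgh; exact hr
    · refine hr.trans (SimpleGraph.Adj.reachable ?_)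
      rw [SimpleGraph.induce_adj]
      exact SimpleGraph.lineGraph_adj_iff_exists.2 ⟨hgh, v, hvg, hvh⟩
  -- `X` is the set of endpoints of the edges in the component of `e`. A surviving edge that meets
  -- `X` belongs to that component, so both its endpoints lie in `X`.
  refine ⟨{v | ∃ (g : G.edgeSet) (hg : g ∉ U),
    (G.lineGraph.induce Uᶜ).Reachable ⟨e, he⟩ ⟨g, hg⟩ ∧ v ∈ g.1}, e, f, he, hf, ?_, ?_, ?_⟩
  · exact fun v hv => ⟨e, he, SimpleGraph.Reachable.refl _, hv⟩
  · rintro v hv ⟨g, hg, hr, hvg⟩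
    exact hef (hstep g f hg hf v hvg hv hr)
  · rintro g x hx y hy ⟨h, hh, hr, hxh⟩ hyX
    by_contra hg
    exact hyX ⟨g, hg, hstep h g hh hg x hxh hx hr, hy⟩

/-- An edge leaving `S` has only one orientation from `S` to its complement, so the pairs counted
inject into `U`. -/
theorem sum_boundary_le_ncard {V : Type*} [Fintype V] [DecidableEq V] {G : SimpleGraph V}
    [DecidableRel G.Adj] {U : Set G.edgeSet} {S : Finset V}
    (hS : ∀ g : G.edgeSet, ∀ x ∈ g.1, ∀ y ∈ g.1, x ∈ S → y ∉ S → g ∈ U) :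
    (∑ x ∈ S, ∑ y ∈ Sᶜ, if G.Adj x y then 1 else 0) ≤ U.ncard := by
  classical
  rw [← Finset.sum_product', ← Finset.card_filter,
    ← Set.ncard_image_of_injective U Subtype.val_injective,
    Set.ncard_eq_toFinset_card']
  refine Finset.card_le_card_of_injOn (fun p => s(p.1, p.2)) ?_ ?_
  · rintro ⟨x, y⟩ h
    simp only [Finset.coe_filter, Finset.mem_product, Finset.mem_compl, Set.mem_ofPred_eq] at h
    simp only [Set.coe_toFinset, Set.mem_image]
    exact ⟨⟨s(x, y), h.2⟩, hS _ x (by simp) y (by simp) h.1.1 h.1.2, rfl⟩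
  · rintro ⟨x, y⟩ h ⟨x', y'⟩ h' heq
    simp only [Finset.coe_filter, Finset.mem_product, Finset.mem_compl, Set.mem_ofPred_eq] at h h'
    rcases Sym2.eq_iff.1 heq with ⟨rfl, rfl⟩ | ⟨rfl, rfl⟩
    · rfl
    · exact absurd h'.1.1 h.1.2

theorem ncard_edgesAt_crossedCube {n : ℕ} {x : BitString n} {e : (crossedCube n).edgeSet}
    (hx : x ∈ e.1) : (edgesAt (crossedCube n) x e).ncard = n - 1 := by
  classical
  rw [ncard_edgesAt hx, crossedCube_degree]

theorem ncard_edgesAt_union_crossedCube {n : ℕ} {x y : BitString n}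
    {e : (crossedCube n).edgeSet} (he : e.1 = s(x, y)) :
    (edgesAt (crossedCube n) x e ∪ edgesAt (crossedCube n) y e).ncard = 2 * n - 2 := by
  rw [Set.ncard_union_eq (disjoint_edgesAt he), ncard_edgesAt_crossedCube (by simp [he]),
    ncard_edgesAt_crossedCube (by simp [he])]
  omega

theorem two_mul_lt_card_edgeSet_crossedCube {n : ℕ} (hn : 4 ≤ n) :
    2 * n < Nat.card (crossedCube n).edgeSet := by
  classical
  have h := (crossedCube n).sum_degrees_eq_twice_card_edges
  simp only [crossedCube_degree, Finset.sum_const, Finset.card_univ, Fintype.card_fun,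
    Fintype.card_bool, Fintype.card_fin, smul_eq_mul] at h
  rw [Nat.card_eq_fintype_card, ← SimpleGraph.edgeFinset_card]
  have h4 : 2 ^ 4 ≤ 2 ^ n := Nat.pow_le_pow_right (by norm_num) hn
  nlinarith

-- With fewer than three vertices, `S` is just the pair of endpoints of `e`, and every other edge at
-- an endpoint leaves `S`.
open Classical in
theorem crossedCube_boundary_dichotomy {n : ℕ} (hn : 4 ≤ n) {U : Set (crossedCube n).edgeSet}
    {S : Finset (BitString n)} {e : (crossedCube n).edgeSet} (heS : ∀ v ∈ e.1, v ∈ S)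
    (hS : S.card ≤ 2 ^ (n - 1))
    (hb : ∀ g : (crossedCube n).edgeSet, ∀ x ∈ g.1, ∀ y ∈ g.1, x ∈ S → y ∉ S → g ∈ U) :
    2 * n - 1 ≤ U.ncard ∨ ∃ x y, e.1 = s(x, y) ∧
      U = edgesAt (crossedCube n) x e ∪ edgesAt (crossedCube n) y e := by
  by_cases h3 : 3 ≤ S.card
  · exact Or.inl ((crossedCube_le_boundary hn h3 hS).trans (sum_boundary_le_ncard hb))
  obtain ⟨x, y, he⟩ : ∃ x y, e.1 = s(x, y) := by
    induction h : e.1 using Sym2.ind with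
    | _ x y => exact ⟨x, y, rfl⟩
  have hxy := e.2
  rw [he, SimpleGraph.mem_edgeSet] at hxy
  have hSxy : {x, y} = S := by
    refine Finset.eq_of_subset_of_card_le ?_ (by rw [Finset.card_pair hxy.ne]; omega)
    intro v hv
    exact heS v (by rw [he]; simpa using hv)
  have hat : ∀ z ∈ e.1, edgesAt (crossedCube n) z e ⊆ U := by
    rintro z hz g ⟨hzg, hne⟩
    obtain ⟨w, hw⟩ := hzg
    have hzw := g.2
    rw [hw, SimpleGraph.mem_edgeSet] at hzw
    refine hb g z (by simp [hw]) w (by simp [hw]) (heS z hz) fun hwS => hne (Subtype.ext ?_)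
    have hwe : w ∈ e.1 := by
      rw [he]
      simpa [← hSxy] using hwS
    rw [hw, (Sym2.mem_and_mem_iff hzw.ne).1 ⟨hz, hwe⟩]
  have hsub : edgesAt (crossedCube n) x e ∪ edgesAt (crossedCube n) y e ⊆ U :=
    Set.union_subset (hat x (by simp [he])) (hat y (by simp [he]))
  by_cases hU : 2 * n - 1 ≤ U.ncard
  · exact Or.inl hU
  -- The neighbourhood of `e` lies in `U` and has `2n - 2` elements, so `|U| < 2n - 1` forces
  -- equality.
  · refine Or.inr ⟨x, y, he, (Set.eq_of_subset_of_ncard_le hsub ?_).symm⟩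
    rw [ncard_edgesAt_union_crossedCube he]
    omega

/-- A vertex cut of the line graph of the crossed cube either has at least `2n - 1` elements or is
the neighbourhood of a vertex. -/
theorem lineGraph_crossedCube_cut_dichotomy {n : ℕ} (hn : 4 ≤ n)
    {U : Set (crossedCube n).edgeSet}
    (hU : ¬ ((crossedCube n).lineGraph.induce Uᶜ).Preconnected) :
    2 * n - 1 ≤ U.ncard ∨ ∃ (e : (crossedCube n).edgeSet) (x y : BitString n), e.1 = s(x, y) ∧
      U = edgesAt (crossedCube n) x e ∪ edgesAt (crossedCube n) y e := by
  classical
  obtain ⟨X, e, f, -, -, heX, hfX, hb⟩ := exists_boundary_subset_of_not_preconnected hU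
  have hcard : X.toFinset.card + X.toFinsetᶜ.card = 2 ^ n := by
    rw [Finset.card_add_card_compl]
    simp
  have hpow : 2 ^ n = 2 * 2 ^ (n - 1) := by
    rw [← pow_succ']
    congr
    omega
  -- The hypotheses are symmetric in the two sides, so the side with at most `2 ^ (n - 1)` vertices
  -- is used, with `e` or `f` as its inner edge.
  rcases le_total X.toFinset.card X.toFinsetᶜ.card with h | h
  · exact (crossedCube_boundary_dichotomy hn (S := X.toFinset) (by simpa using heX) (by omega)
      (by simpa using hb)).imp_right fun h => ⟨e, h⟩
  · refine (crossedCube_boundary_dichotomy hn (S := X.toFinsetᶜ) (by simpa using hfX)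
      (by omega) ?_).imp_right fun h => ⟨f, h⟩
    intro g x hx y hy hxX hyX
    exact hb g y hy x hx (by simpa using hyX) (by simpa using hxX)

/-! ### Lower bound for substructure cuts -/

theorem SimpleGraph.Subgraph.verts_subset_or_of_connected {V : Type*} {G : SimpleGraph V}
    {S : G.Subgraph} (hS : S.Connected) {A B : Set V} (hAB : S.verts ⊆ A ∪ B)
    (h : ∀ a ∈ A, ∀ b ∈ B, ¬ G.Adj a b) : S.verts ⊆ A ∨ S.verts ⊆ B := by
  have hc := (SimpleGraph.Subgraph.connected_iff'.1 hS)
  have key : ∀ u v : S.verts, S.coe.Reachable u v → (u.1 ∈ A ↔ v.1 ∈ A) := by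
    rintro u v ⟨p⟩
    induction p with
    | nil => rfl
    | @cons a b c hadj p ih =>
      rw [← ih]
      have hG : G.Adj a.1 b.1 := S.adj_sub hadj
      constructor
      · intro ha
        exact (hAB b.2).resolve_right fun hb => h _ ha _ hb hG
      · intro hb
        exact (hAB a.2).resolve_right fun ha => h _ hb _ ha hG.symm
  obtain ⟨u⟩ := hc.nonempty
  by_cases hu : u.1 ∈ A
  · exact Or.inl fun v hv => (key u ⟨v, hv⟩ (hc.preconnected _ _)).1 hu
  · exact Or.inr fun v hv => (hAB hv).resolve_left fun hvA =>
      hu ((key u ⟨v, hv⟩ (hc.preconnected _ _)).2 hvA)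

/-- The first alternative is counting for cuts with at least `2n - 1` vertices. In the second the
cut is the neighbourhood of an edge, and `p`, `q` count the members inside its two cliques. -/
theorem lineGraph_crossedCube_substructureCut_card {n k : ℕ} (hn : 4 ≤ n)
    {H : SimpleGraph (Fin k)} {F : Set (crossedCube n).lineGraph.Subgraph}
    (hF : IsSubstructureCut (crossedCube n).lineGraph H F) (hfin : F.Finite) :
    2 * n - 1 ≤ F.ncard * k ∨
      ∃ p q, p + q ≤ F.ncard ∧ n - 1 ≤ p * k ∧ n - 1 ≤ q * k := by
  obtain ⟨hcut, hK⟩ := hF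
  have hle : ∀ S ∈ F, S.verts.ncard ≤ k := fun S hS => by
    obtain ⟨K, -, ⟨e⟩⟩ := hK S hS
    exact ncard_verts_le_of_iso e
  have hconn : ∀ S ∈ F, S.Connected := fun S hS => by
    obtain ⟨K, hc, ⟨e⟩⟩ := hK S hS
    exact SimpleGraph.Subgraph.connected_iff'.2
      (e.connected_iff.2 (SimpleGraph.Subgraph.connected_iff'.1 hc))
  have hU := ncard_biUnion_verts_le hfin hle
  rcases hcut with hcut | ⟨x, hx⟩
  · rcases lineGraph_crossedCube_cut_dichotomy hn hcut with h | ⟨e, x, y, he, hUe⟩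
    · exact Or.inl (h.trans hU)
    right
    have hdis := disjoint_edgesAt he
    have hsplit : ∀ S ∈ F, S.verts ⊆ edgesAt (crossedCube n) x e ∨
        S.verts ⊆ edgesAt (crossedCube n) y e := fun S hS =>
      SimpleGraph.Subgraph.verts_subset_or_of_connected (hconn S hS)
        (hUe ▸ Set.subset_biUnion_of_mem (u := fun S => S.verts) hS)
        (fun g hg h hh => not_adj_edgesAt (fun _ _ _ => crossedCube_triangle_free) he hg hh)
    -- A member that meets `A` cannot lie in `B`, so the members inside `A` already cover `A`.
    have hbound : ∀ A B : Set (crossedCube n).edgeSet, Disjoint A B →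
        (∀ S ∈ F, S.verts ⊆ A ∨ S.verts ⊆ B) → A ⊆ ⋃ S ∈ F, S.verts →
        A.ncard ≤ {S ∈ F | S.verts ⊆ A}.ncard * k := by
      intro A B hAB hs hA
      refine le_trans (Set.ncard_le_ncard ?_ (Set.toFinite _))
        (ncard_biUnion_verts_le (hfin.subset (Set.sep_subset _ _)) fun S hS => hle S hS.1)
      intro g hg
      obtain ⟨S, hS, hgS⟩ := Set.mem_iUnion₂.1 (hA hg)
      exact Set.mem_iUnion₂.2 ⟨S, ⟨hS, (hs S hS).resolve_right fun h =>
        Set.disjoint_left.1 hAB hg (h hgS)⟩, hgS⟩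
    refine ⟨{S ∈ F | S.verts ⊆ edgesAt (crossedCube n) x e}.ncard,
      {S ∈ F | S.verts ⊆ edgesAt (crossedCube n) y e}.ncard, ?_, ?_, ?_⟩
    · rw [← Set.ncard_union_eq ?_ (hfin.subset (Set.sep_subset _ _))
        (hfin.subset (Set.sep_subset _ _))]
      · exact Set.ncard_le_ncard (Set.union_subset (Set.sep_subset _ _) (Set.sep_subset _ _)) hfin
      · rw [Set.disjoint_left]
        rintro S ⟨hS, h1⟩ ⟨-, h2⟩
        obtain ⟨g, hg⟩ := (hconn S hS).nonempty
        exact Set.disjoint_left.1 hdis (h1 hg) (h2 hg)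
    · rw [← ncard_edgesAt_crossedCube (x := x) (e := e) (by simp [he])]
      exact hbound _ _ hdis hsplit (hUe ▸ Set.subset_union_left)
    · rw [← ncard_edgesAt_crossedCube (x := y) (e := e) (by simp [he])]
      exact hbound _ _ hdis.symm (fun S hS => (hsplit S hS).symm) (hUe ▸ Set.subset_union_right)
  -- If a single vertex remains, then at least `2n` vertices were deleted.
  · left
    have h1 := Set.ncard_add_ncard_compl (⋃ S ∈ F, S.verts)
    rw [hx, Set.ncard_singleton] at h1
    have := two_mul_lt_card_edgeSet_crossedCube hn
    omega

/-! ### Constructing small cuts -/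

/-- Any ordering of a clique is a path. The last vertex is prescribed so that the path can be
continued from it. -/
theorem exists_list_of_clique {V : Type*} {G : SimpleGraph V} {A : Set V} (hA : A.Finite)
    (hc : ∀ u ∈ A, ∀ v ∈ A, u ≠ v → G.Adj u v) {a : V} (ha : a ∈ A) :
    ∃ l : List V, (l ++ [a]).IsChain G.Adj ∧ (l ++ [a]).Nodup ∧ {v | v ∈ l ++ [a]} = A := by
  classical
  have hmem : ∀ v, v ∈ (hA.toFinset.erase a).toList ++ [a] ↔ v ∈ A := by
    intro v
    by_cases h : v = a <;> simp [h, ha]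
  have hnd : ((hA.toFinset.erase a).toList ++ [a]).Nodup := by
    rw [List.nodup_append]
    refine ⟨Finset.nodup_toList _, List.nodup_singleton a, ?_⟩
    rintro u hu v hv rfl
    simp_all
  exact ⟨_, (hnd.imp_of_mem fun hu hv hne =>
    hc _ ((hmem _).1 hu) _ ((hmem _).1 hv) hne).isChain, hnd, Set.ext hmem⟩

theorem List.Nodup.length_eq_ncard {V : Type*} {l : List V} (h : l.Nodup) {A : Set V}
    (hA : {v | v ∈ l} = A) : l.length = A.ncard := by
  classical
  rw [← hA, ← List.toFinset_card_of_nodup h, ← Set.ncard_coe_finset]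
  congr
  ext v
  simp

/-- Deleting its whole neighbourhood isolates `e`. The bound on the number of deleted vertices
guarantees another surviving vertex, which `e` cannot reach. -/
theorem isSubgraphCut_of_edgesAt_subset {n : ℕ} (hn : 4 ≤ n)
    {F : Set (crossedCube n).lineGraph.Subgraph} {e : (crossedCube n).edgeSet}
    {x y : BitString n} (he : e.1 = s(x, y)) (heF : e ∉ ⋃ S ∈ F, S.verts)
    (hx : edgesAt (crossedCube n) x e ⊆ ⋃ S ∈ F, S.verts)
    (hy : edgesAt (crossedCube n) y e ⊆ ⋃ S ∈ F, S.verts)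
    (hcard : (⋃ S ∈ F, S.verts).ncard ≤ 2 * n - 1) :
    IsSubgraphCut (crossedCube n).lineGraph F := by
  left
  obtain ⟨f, hf⟩ : ∃ f, f ∉ insert e (⋃ S ∈ F, S.verts) := by
    by_contra! h
    have h1 := Set.ncard_insert_le e (⋃ S ∈ F, S.verts)
    rw [Set.eq_univ_of_forall h, Set.ncard_univ] at h1
    have := two_mul_lt_card_edgeSet_crossedCube hn
    omega
  rw [Set.mem_insert_iff, not_or] at hf
  intro hp
  obtain ⟨p⟩ := hp ⟨e, heF⟩ ⟨f, hf.2⟩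
  cases p with
  | nil => exact hf.1 rfl
  | @cons _ g _ hadj p =>
    rw [SimpleGraph.induce_adj, SimpleGraph.lineGraph_adj_iff_exists] at hadj
    obtain ⟨hne, v, hve, hvg⟩ := hadj
    change v ∈ e.1 at hve
    rw [he, Sym2.mem_iff] at hve
    rcases hve with rfl | rfl
    · exact g.2 (hx ⟨hvg, hne.symm⟩)
    · exact g.2 (hy ⟨hvg, hne.symm⟩)

theorem substructureConnectivity_le_of_isSubstructureCut {V W : Type*} {G : SimpleGraph V}
    {H : SimpleGraph W} {F : Set G.Subgraph} (h : IsSubstructureCut G H F) :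
    substructureConnectivity G H ≤ F.encard :=
  iInf₂_le F h

/-- The two cliques around an edge are covered separately, by at most `m` pieces each. -/
theorem substructureConnectivity_lineGraph_crossedCube_le_two_mul {n k m : ℕ} (hn : 4 ≤ n)
    {H : SimpleGraph (Fin k)} (hH : SimpleGraph.pathGraph k ≤ H) (hm : n - 1 ≤ m * k) :
    substructureConnectivity (crossedCube n).lineGraph H ≤ (2 * m : ℕ) := by
  obtain ⟨x, y, a, b, hxy, hxa, hyb, -, hay, hbx⟩ :=
    crossedCube_exists_four_cycle (n := n) (by omega)
  let e : (crossedCube n).edgeSet := ⟨s(x, y), hxy⟩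
  have key : ∀ z ∈ e.1, ∀ c, (crossedCube n).Adj z c → s(z, c) ≠ e.1 →
      ∃ F : Set (crossedCube n).lineGraph.Subgraph, F.encard ≤ m ∧
        (⋃ S ∈ F, S.verts) = edgesAt (crossedCube n) z e ∧
        ∀ S ∈ F, ∃ K : H.Subgraph, K.Connected ∧ Nonempty (S.coe ≃g K.coe) := by
    intro z hz c hzc hne
    obtain ⟨l, hc, hd, hl⟩ := exists_list_of_clique (G := (crossedCube n).lineGraph)
      (A := edgesAt (crossedCube n) z e) (Set.toFinite _)
      (fun _ hu _ hv h => isClique_edgesAt hu hv h) (a := ⟨s(z, c), hzc⟩)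
      ⟨by simp, fun h => hne (congrArg Subtype.val h)⟩
    rw [← hl]
    refine exists_cover_of_isChain hH m hc hd ?_
    rwa [hd.length_eq_ncard hl, ncard_edgesAt_crossedCube hz]
  obtain ⟨F₁, hF₁, hU₁, hK₁⟩ := key x (by simp [e]) a hxa (by simp [e, hay, hxy.ne])
  obtain ⟨F₂, hF₂, hU₂, hK₂⟩ := key y (by simp [e]) b hyb (by simp [e, hbx, hxy.ne.symm])
  have hU : (⋃ S ∈ F₁ ∪ F₂, S.verts) =
      edgesAt (crossedCube n) x e ∪ edgesAt (crossedCube n) y e := by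
    rw [Set.biUnion_union, hU₁, hU₂]
  refine (substructureConnectivity_le_of_isSubstructureCut (F := F₁ ∪ F₂) ⟨?_, ?_⟩).trans ?_
  · refine isSubgraphCut_of_edgesAt_subset hn (e := e) (x := x) (y := y) rfl ?_ ?_ ?_ ?_ <;> rw [hU]
    · rintro (h | h) <;> exact h.2 rfl
    · exact Set.subset_union_left
    · exact Set.subset_union_right
    · rw [ncard_edgesAt_union_crossedCube rfl]
      omega
  · rintro S (hS | hS)
    exacts [hK₁ S hS, hK₂ S hS]
  · refine (Set.encard_union_le _ _).trans ((add_le_add hF₁ hF₂).trans ?_)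
    rw [two_mul]
    push_cast
    exact le_rfl

/-- One path runs through the clique at `x` to `xa`, crosses `ab`, and returns from `yb` through the
clique at `y`. It has `2n - 1` vertices and avoids `e = xy`, so pieces may straddle the two cliques.
-/
theorem substructureConnectivity_lineGraph_crossedCube_le {n k m : ℕ} (hn : 4 ≤ n)
    {H : SimpleGraph (Fin k)} (hH : SimpleGraph.pathGraph k ≤ H) (hm : 2 * n - 1 ≤ m * k) :
    substructureConnectivity (crossedCube n).lineGraph H ≤ m := by
  obtain ⟨x, y, a, b, hxy, hxa, hyb, hab, hay, hbx⟩ :=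
    crossedCube_exists_four_cycle (n := n) (by omega)
  let e : (crossedCube n).edgeSet := ⟨s(x, y), hxy⟩
  let xa : (crossedCube n).edgeSet := ⟨s(x, a), hxa⟩
  let yb : (crossedCube n).edgeSet := ⟨s(y, b), hyb⟩
  let ab : (crossedCube n).edgeSet := ⟨s(a, b), hab⟩
  have hxae : xa ≠ e := fun h => by
    have := congrArg Subtype.val h
    simp [e, xa, hay, hxy.ne] at this
  have hybe : yb ≠ e := fun h => by
    have := congrArg Subtype.val h
    simp [e, yb, hbx, hxy.ne.symm] at this
  have hxab : x ∉ ab.1 := by simp [ab, hxa.ne, hbx.symm]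
  have hyab : y ∉ ab.1 := by simp [ab, hay.symm, hyb.ne]
  obtain ⟨l₁, hc₁, hd₁, hl₁⟩ := exists_list_of_clique (G := (crossedCube n).lineGraph)
    (A := edgesAt (crossedCube n) x e) (Set.toFinite _)
    (fun _ hu _ hv h => isClique_edgesAt hu hv h) (a := xa) ⟨by simp [xa], hxae⟩
  obtain ⟨l₂, hc₂, hd₂, hl₂⟩ := exists_list_of_clique (G := (crossedCube n).lineGraph)
    (A := edgesAt (crossedCube n) y e) (Set.toFinite _)
    (fun _ hu _ hv h => isClique_edgesAt hu hv h) (a := yb) ⟨by simp [yb], hybe⟩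
  have hm₁ : ∀ g, g ∈ l₁ ++ [xa] ↔ g ∈ edgesAt (crossedCube n) x e := fun g => by
    rw [← hl₁]; rfl
  have hm₂ : ∀ g, g ∈ (l₂ ++ [yb]).reverse ↔ g ∈ edgesAt (crossedCube n) y e := fun g => by
    rw [← hl₂, List.mem_reverse]; rfl
  have hdis := Set.disjoint_left.1 (disjoint_edgesAt (G := crossedCube n) (e := e) rfl)
  have hadj₁ : (crossedCube n).lineGraph.Adj xa ab := SimpleGraph.lineGraph_adj_iff_exists.2
    ⟨fun h => hxab (h ▸ by simp [xa]), a, by simp [xa], by simp [ab]⟩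
  have hadj₂ : (crossedCube n).lineGraph.Adj ab yb := SimpleGraph.lineGraph_adj_iff_exists.2
    ⟨fun h => hyab (h ▸ by simp [yb]), b, by simp [ab], by simp [yb]⟩
  have hnd : ((l₁ ++ [xa]) ++ (ab :: (l₂ ++ [yb]).reverse)).Nodup := by
    rw [List.nodup_append]
    refine ⟨hd₁, List.nodup_cons.2 ⟨fun h => hyab ((hm₂ _).1 h).1, List.nodup_reverse.2 hd₂⟩, ?_⟩
    rintro g hg h hh rfl
    rcases List.mem_cons.1 hh with rfl | hh
    · exact hxab ((hm₁ _).1 hg).1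
    · exact hdis ((hm₁ _).1 hg) ((hm₂ _).1 hh)
  have hchain : ((l₁ ++ [xa]) ++ (ab :: (l₂ ++ [yb]).reverse)).IsChain
      (crossedCube n).lineGraph.Adj := by
    rw [List.isChain_append]
    refine ⟨hc₁, ?_, by simpa using hadj₁⟩
    have hrev : (l₂ ++ [yb]).reverse.IsChain (crossedCube n).lineGraph.Adj := by
      rw [List.isChain_reverse]
      exact hc₂.imp fun _ _ h => h.symm
    rw [List.reverse_append] at hrev ⊢
    exact List.isChain_cons_cons.2 ⟨hadj₂, hrev⟩
  have hset : {g | g ∈ (l₁ ++ [xa]) ++ (ab :: (l₂ ++ [yb]).reverse)} =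
      insert ab (edgesAt (crossedCube n) x e ∪ edgesAt (crossedCube n) y e) := by
    ext g
    change g ∈ (l₁ ++ [xa]) ++ (ab :: (l₂ ++ [yb]).reverse) ↔ _
    rw [List.mem_append, List.mem_cons, hm₁, hm₂, Set.mem_insert_iff, Set.mem_union]
    tauto
  have hcard : (insert ab (edgesAt (crossedCube n) x e ∪ edgesAt (crossedCube n) y e)).ncard ≤
      2 * n - 1 := by
    refine (Set.ncard_insert_le _ _).trans ?_
    rw [ncard_edgesAt_union_crossedCube rfl]
    omega
  obtain ⟨F, hF, hU, hK⟩ := exists_cover_of_isChain hH m hchain hnd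
    (by rw [hnd.length_eq_ncard hset]; exact hcard.trans hm)
  rw [hset] at hU
  refine (substructureConnectivity_le_of_isSubstructureCut (F := F) ⟨?_, hK⟩).trans hF
  refine isSubgraphCut_of_edgesAt_subset hn (e := e) (x := x) (y := y) rfl ?_ ?_ ?_ ?_ <;> rw [hU]
  · rintro (h | h | h)
    · exact hxab (h ▸ by simp [e])
    · exact h.2 rfl
    · exact h.2 rfl
  · exact Set.subset_union_left.trans (Set.subset_insert _ _)
  · exact Set.subset_union_right.trans (Set.subset_insert _ _)
  · exact hcard

/-! ### Exact values -/

theorem le_substructureConnectivity_of_finite {V W : Type*} {G : SimpleGraph V}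
    {H : SimpleGraph W} {m : ℕ}
    (h : ∀ F, IsSubstructureCut G H F → F.Finite → m ≤ F.ncard) :
    (m : ℕ∞) ≤ substructureConnectivity G H := by
  refine le_iInf₂ fun F hF => ?_
  by_cases hfin : F.Finite
  · rw [← hfin.cast_ncard_eq]
    exact_mod_cast h F hF hfin
  · rw [Set.Infinite.encard_eq hfin]
    exact le_top

theorem substructureConnectivity_lineGraph_crossedCube_of_dvd {n k : ℕ} (hn : 4 ≤ n)
    (hk : 0 < k) {H : SimpleGraph (Fin k)} (hH : SimpleGraph.pathGraph k ≤ H)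
    (hd : k ∣ n - 1) :
    substructureConnectivity (crossedCube n).lineGraph H = ((2 * n - 2) / k : ℕ) := by
  obtain ⟨q, hq⟩ := hd
  have hdiv : (2 * n - 2) / k = 2 * q := by
    have : 2 * n - 2 = k * (2 * q) := by
      have : 2 * n - 2 = 2 * (n - 1) := by omega
      rw [this, hq]
      ring
    rw [this, Nat.mul_div_cancel_left _ hk]
  rw [hdiv]
  refine le_antisymm (substructureConnectivity_lineGraph_crossedCube_le_two_mul hn hH
    (by rw [hq, mul_comm])) (le_substructureConnectivity_of_finite fun F hF hfin => ?_)
  refine Nat.le_of_mul_le_mul_right ?_ hk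
  have h2 : 2 * q * k = 2 * (n - 1) := by rw [hq]; ring
  rcases lineGraph_crossedCube_substructureCut_card hn hF hfin with h | ⟨a, b, hab, ha, hb⟩
  · omega
  · have := Nat.mul_le_mul_right k hab
    rw [add_mul] at this
    omega

theorem substructureConnectivity_lineGraph_crossedCube_of_not_dvd {n k : ℕ} (hn : 4 ≤ n)
    (hk : 0 < k) {H : SimpleGraph (Fin k)} (hH : SimpleGraph.pathGraph k ≤ H)
    (hd : ¬ k ∣ n - 1) :
    substructureConnectivity (crossedCube n).lineGraph H = ⌈(2 * (n : ℚ) - 1) / (k : ℚ)⌉₊ := by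
  have hceil : ∀ m : ℕ, ⌈(2 * (n : ℚ) - 1) / (k : ℚ)⌉₊ ≤ m ↔ 2 * n - 1 ≤ m * k := by
    intro m
    rw [Nat.ceil_le, div_le_iff₀ (by exact_mod_cast hk), sub_le_iff_le_add, Nat.sub_le_iff_le_add]
    norm_cast
  refine le_antisymm (substructureConnectivity_lineGraph_crossedCube_le hn hH
    ((hceil _).1 le_rfl)) (le_substructureConnectivity_of_finite fun F hF hfin => (hceil _).2 ?_)
  rcases lineGraph_crossedCube_substructureCut_card hn hF hfin with h | ⟨a, b, hab, ha, hb⟩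
  · exact h
  · have := Nat.mul_le_mul_right k hab
    rw [add_mul] at this
    -- Non-divisibility makes both inequalities strict, so the total is at least `2n`.
    have ha' : n - 1 ≠ a * k := fun h => hd ⟨a, by rw [h, mul_comm]⟩
    have hb' : n - 1 ≠ b * k := fun h => hd ⟨b, by rw [h, mul_comm]⟩
    omega

theorem theorem4p12 (n k : ℕ) (hn : 4 ≤ n) (hk : 4 ≤ k) (hkn : k ≤ 2 * n - 1) :
    substructureConnectivity (bcdc n) (SimpleGraph.cycleGraph k) =
        substructureConnectivity (bcdc n) (SimpleGraph.pathGraph k) ∧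
      ((k ≤ n - 1 ∧ k ∣ n - 1) →
        substructureConnectivity (bcdc n) (SimpleGraph.cycleGraph k) =
          (((2 * n - 2) / k : ℕ) : ℕ∞)) ∧
      (¬ (k ≤ n - 1 ∧ k ∣ n - 1) →
        substructureConnectivity (bcdc n) (SimpleGraph.cycleGraph k) =
          ((⌈(2 * (n : ℚ) - 1) / (k : ℚ)⌉₊ : ℕ) : ℕ∞)) := by
  have hk0 : 0 < k := by omega
  have hC := SimpleGraph.pathGraph_le_cycleGraph (n := k)
  rw [bcdc_eq_lineGraph]
  -- As `n - 1 > 0`, the case distinction reduces to divisibility.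
  have hdvd : k ∣ n - 1 → k ≤ n - 1 := Nat.le_of_dvd (by omega)
  refine ⟨?_, fun h => substructureConnectivity_lineGraph_crossedCube_of_dvd hn hk0 hC h.2,
    fun h => substructureConnectivity_lineGraph_crossedCube_of_not_dvd hn hk0 hC
      fun hd => h ⟨hdvd hd, hd⟩⟩
  by_cases hd : k ∣ n - 1
  · rw [substructureConnectivity_lineGraph_crossedCube_of_dvd hn hk0 hC hd,
      substructureConnectivity_lineGraph_crossedCube_of_dvd hn hk0 le_rfl hd]
  · rw [substructureConnectivity_lineGraph_crossedCube_of_not_dvd hn hk0 hC hd,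
      substructureConnectivity_lineGraph_crossedCube_of_not_dvd hn hk0 le_rfl hd]
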